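/- Let $d,N\ge 1$ be integers and let $s$ be a real number with $0<2s\le d$. Let $H^s(\mathbb{R}^{dN})$ be the space of all $u\in L^2(\mathbb{R}^{dN};\mathbb{C})$ with $\|u\|_{H^s}^2:=\|u\|_{L^2}^2+\int_{\mathbb{R}^{dN}}|\mathrm p|^{2s}|\widehat u(\mathrm p)|^2\,d\mathrm p<\infty$, where $\widehat u$ is the Fourier transform with kernel $(2\pi)^{-dN/2}e^{-i\mathrm p\cdot \mathrm x}$. Write points of $\mathbb{R}^{dN}=(\mathbb{R}^d)^N$ as $\mathrm x=(\mathbf x_1,\dots,\mathbf x_N)$ and let $$\Delta:=\{\mathrm x\in(\mathbb{R}^d)^N:\ \mathbf x_i=\mathbf x_j\text{ for some } i\ne j\}.$$ Let the hard-core space $\mathcal H^{s,N}_0(\mathbb{R}^d)$ be the closure in $H^s(\mathbb{R}^{dN})$ of $C_c^\infty(\mathbb{R}^{dN}\setminus\Delta)$, and let the diagonal-vanishing space $\mathcal H^{s,N}(\mathbb{R}^d)$ be the closure in $H^s(\mathbb{R}^{dN})$ of $\{\Psi\in C_c^\infty(\mathbb{R}^{dN}):\Psi|_{\Delta}=0\}$.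 Then $$\mathcal H^{s,N}_0(\mathbb{R}^d)=\mathcal H^{s,N}(\mathbb{R}^d)=H^s(\mathbb{R}^{dN}).$$ -/

import Mathlib

open MeasureTheory
open scoped FourierTransform ENNReal ContDiff

/-- The `N`-particle configuration space `(ℝ^d)^N = ℝ^{dN}` with its Euclidean norm and Lebesgue
measure; `x i : ℝ^d` is the position of particle `i`. -/
abbrev Config (d N : ℕ) : Type := PiLp 2 (fun _ : Fin N => EuclideanSpace ℝ (Fin d))

/-- `L²(ℝ^{dN})`, complex valued. -/
abbrev L2Config (d N : ℕ) : Type := Lp ℂ 2 (volume : Measure (Config d N))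

/-- The diagonal set: two particles with different labels sit at the same point. -/
def diagonalSet (d N : ℕ) : Set (Config d N) :=
  {x | ∃ i j : Fin N, i ≠ j ∧ x i = x j}

noncomputable section

/-- The squared homogeneous seminorm `⟨u, (-Δ)^s u⟩`. Mathlib's Fourier transform uses
`exp (-2πi ⟨x, ξ⟩)`, hence `(-Δ)^s` is multiplication by `(2π|ξ|)^{2s}`. The value is `∞` outside
the form domain of `(-Δ)^s`. -/
def homSobolevSq {d N : ℕ} (s : ℝ) (u : L2Config d N) : ℝ≥0∞ :=
  ∫⁻ ξ : Config d N,
    ENNReal.ofReal ((2 * Real.pi * ‖ξ‖) ^ (2 * s)) * ‖(𝓕 u : L2Config d N) ξ‖ₑ ^ 2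

/-- The norm `(‖u‖_{L²}² + ⟨u, (-Δ)^s u⟩)^{1/2}` of `H^s(ℝ^{dN})`, with value `∞` outside it. -/
def sobolevNorm {d N : ℕ} (s : ℝ) (u : L2Config d N) : ℝ≥0∞ :=
  (‖u‖ₑ ^ 2 + homSobolevSq s u) ^ (1 / 2 : ℝ)

/-- The Sobolev space `H^s(ℝ^{dN})`. -/
def sobolevSpace (d N : ℕ) (s : ℝ) : Set (L2Config d N) :=
  {u | sobolevNorm s u < ⊤}

/-- The closure of a set `S` of functions in `H^s(ℝ^{dN})` for the `H^s` norm. -/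
def sobolevClosure {d N : ℕ} (s : ℝ) (S : Set (L2Config d N)) : Set (L2Config d N) :=
  {u | u ∈ sobolevSpace d N s ∧
    ∀ ε : ℝ≥0∞, 0 < ε → ∃ v ∈ S, v ∈ sobolevSpace d N s ∧ sobolevNorm s (u - v) < ε}

/-- The (classes of the) functions in `C_c^∞(ℝ^{dN} \ diagonal)`: smooth, with compact support
contained in the complement of the diagonal set. -/
def testOffDiagonal (d N : ℕ) : Set (L2Config d N) :=
  {v | ∃ Φ : Config d N → ℂ, ContDiff ℝ ∞ Φ ∧ HasCompactSupport Φ ∧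
    tsupport Φ ⊆ (diagonalSet d N)ᶜ ∧ v =ᵐ[volume] Φ}

/-- The (classes of the) functions in `C_c^∞(ℝ^{dN})` that vanish on the diagonal set. -/
def testVanishing (d N : ℕ) : Set (L2Config d N) :=
  {v | ∃ Φ : Config d N → ℂ, ContDiff ℝ ∞ Φ ∧ HasCompactSupport Φ ∧
    (∀ x ∈ diagonalSet d N, Φ x = 0) ∧ v =ᵐ[volume] Φ}

/-- The hard-core space `𝓗₀^{s,N}(ℝ^d)`. -/
def hardCoreSpace (d N : ℕ) (s : ℝ) : Set (L2Config d N) :=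
  sobolevClosure s (testOffDiagonal d N)

/-- The space `𝓗^{s,N}(ℝ^d)` of functions vanishing on the diagonal set. -/
def diagonalVanishingSpace (d N : ℕ) (s : ℝ) : Set (L2Config d N) :=
  sobolevClosure s (testVanishing d N)

end

/-! The inclusions hard-core ⊆ diagonal-vanishing ⊆ `H^s` are immediate; the content is that `C_c^∞`
off the diagonal is dense in `H^s`. The diagonal is a finite union of planes `x i = x j` of
codimension `d ≥ 2s`, and such a plane carries no `H^s` information.

To remove one plane `L x = 0` from the support of a test function `Φ`, subtract `g = θ(R L x) Φ`. It
lives in a tube of volume `O(R^{-d})`, and its derivatives of order `d` are `O(R^d)`. Interpolating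
between orders `0` and `d` gives `‖g‖²_{H^s} ≲ R^d · R^{-d}`: bounded as `R → ∞`, while `g → 0` in
`L²`. In the critical case `2s = d` this does not give smallness, but boundedness suffices: a
subspace is weakly closed, so an `H^s`-bounded sequence in it that converges in `L²` to an element
of `H^s` has its limit in the `H^s` closure (`mem_sobolevClosure_of_bounded_of_tendsto`). Hence no
logarithmic cutoff is needed.

`testAvoiding_subset_sobolevClosure` is this one-plane step. Induction over pairs of particles
removes all planes, starting from the density of Schwartz functions and then of compactly supported
ones. -/

/-! ### Weak closedness of subspaces in Hilbert space. -/

/-- If `K` is an injective bounded operator between Hilbert spaces, then a bounded sequence in a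
subspace `W` whose image under `K` converges to `K a` forces `a` to lie in the closure of `W`. -/
theorem mem_topologicalClosure_of_bounded_of_tendsto {H H' : Type*}
    [NormedAddCommGroup H] [InnerProductSpace ℂ H] [CompleteSpace H]
    [NormedAddCommGroup H'] [InnerProductSpace ℂ H'] [CompleteSpace H']
    (K : H →L[ℂ] H') (hK : Function.Injective K) (W : Submodule ℂ H) {a : H} {b : ℕ → H}
    (hb : ∀ n, b n ∈ W) {C : ℝ} (hC : ∀ n, ‖b n‖ ≤ C)
    (hlim : Filter.Tendsto (fun n ↦ K (b n)) Filter.atTop (nhds (K a))) :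
    a ∈ W.topologicalClosure := by
  rw [← Submodule.orthogonal_orthogonal_eq_closure, Submodule.mem_orthogonal]
  intro h hh
  -- Injectivity of `K` makes the range of its adjoint dense, so a vector `h ⟂ W` can be replaced by
  -- some `K† y`, against which `b n` is seen only through `K (b n)`.
  have hdense : Dense ((LinearMap.range (ContinuousLinearMap.adjoint K).toLinearMap : Submodule ℂ H) : Set H) := by
    rw [Submodule.dense_iff_topologicalClosure_eq_top, Submodule.topologicalClosure_eq_top_iff,
      ContinuousLinearMap.orthogonal_range, ContinuousLinearMap.adjoint_adjoint]
    exact LinearMap.ker_eq_bot.2 hK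
  have hC0 : 0 ≤ C := (norm_nonneg _).trans (hC 0)
  by_contra hne
  have hpos : 0 < ‖(inner ℂ h a : ℂ)‖ := norm_pos_iff.2 hne
  set η := ‖(inner ℂ h a : ℂ)‖ with hη
  -- The radius makes `‖h - g‖ (‖a‖ + C)` less than `η / 2`; the `+ 1` keeps the denominator
  -- positive.
  obtain ⟨g, hg, hgd⟩ := Metric.dense_iff.1 hdense h (η / (2 * (‖a‖ + C + 1))) (by positivity)
  obtain ⟨y, rfl⟩ := hgd
  rw [Metric.mem_ball, dist_comm, dist_eq_norm, lt_div_iff₀ (by positivity)] at hg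
  have hlim' : Filter.Tendsto (fun n ↦ (inner ℂ y (K a - K (b n)) : ℂ)) Filter.atTop (nhds 0) := by
    have h2 := (tendsto_const_nhds (x := y)).inner (𝕜 := ℂ) (hlim.const_sub (K a))
    simpa only [sub_self, inner_zero_right] using h2
  obtain ⟨n, hn⟩ := ((tendsto_zero_iff_norm_tendsto_zero.1 hlim').eventually
    (gt_mem_nhds (half_pos hpos))).exists
  set g := ContinuousLinearMap.adjoint K y with hgdef
  have h0 : (inner ℂ h (b n) : ℂ) = 0 := by
    rw [← inner_conj_symm, (Submodule.mem_orthogonal _ _).1 hh _ (hb n), map_zero]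
  have e : (inner ℂ h a : ℂ) = inner ℂ (h - g) (a - b n) + inner ℂ y (K a - K (b n)) := by
    rw [← map_sub, ← ContinuousLinearMap.adjoint_inner_left, ← inner_add_left, sub_add_cancel,
      inner_sub_right, h0, sub_zero]
  have h1 : ‖(inner ℂ (h - g) (a - b n) : ℂ)‖ ≤ ‖h - g‖ * (‖a‖ + C) :=
    (norm_inner_le_norm _ _).trans
      (mul_le_mul_of_nonneg_left ((norm_sub_le _ _).trans (add_le_add_right (hC n) _)) (norm_nonneg _))
  have h2 : η ≤ ‖h - g‖ * (‖a‖ + C) + ‖(inner ℂ y (K a - K (b n)) : ℂ)‖ := by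
    rw [hη, e]; exact (norm_add_le _ _).trans (add_le_add_left h1 _)
  have h3 : ‖h - g‖ * (‖a‖ + C) ≤ ‖h - g‖ * (‖a‖ + C + 1) :=
    mul_le_mul_of_nonneg_left (by linarith) (norm_nonneg _)
  have hg' : ‖h - g‖ * (2 * (‖a‖ + C + 1)) < η := hg
  linarith

/-! ### The Fourier model of `H^s` and its closures. -/

noncomputable section

variable {d N : ℕ}

/-- The squared Fourier weight `1 + |2πξ|^{2s}` of the `H^s` norm. -/
def sobolevWeight {E : Type*} [NormedAddCommGroup E] (s : ℝ) (ξ : E) : ℝ :=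
  1 + (2 * Real.pi * ‖ξ‖) ^ (2 * s)

section weight
variable {E : Type*} [NormedAddCommGroup E]

theorem one_le_sobolevWeight (s : ℝ) (ξ : E) : 1 ≤ sobolevWeight s ξ := by
  have : 0 ≤ (2 * Real.pi * ‖ξ‖) ^ (2 * s) := by positivity
  simpa [sobolevWeight] using this

theorem sobolevWeight_pos (s : ℝ) (ξ : E) : 0 < sobolevWeight s ξ :=
  zero_lt_one.trans_le (one_le_sobolevWeight s ξ)

theorem continuous_sobolevWeight {s : ℝ} (hs : 0 ≤ s) :
    Continuous (sobolevWeight s : E → ℝ) := by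
  unfold sobolevWeight
  exact continuous_const.add ((continuous_const.mul continuous_norm).rpow_const
    fun _ ↦ Or.inr (by linarith))

theorem measurable_sobolevWeight [MeasurableSpace E] [OpensMeasurableSpace E] (s : ℝ) :
    Measurable (sobolevWeight s : E → ℝ) := by
  unfold sobolevWeight
  fun_prop

theorem ofReal_sobolevWeight (s : ℝ) (ξ : E) :
    ENNReal.ofReal (sobolevWeight s ξ) =
      1 + ENNReal.ofReal ((2 * Real.pi * ‖ξ‖) ^ (2 * s)) := by
  rw [sobolevWeight, ENNReal.ofReal_add zero_le_one (by positivity), ENNReal.ofReal_one]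

end weight

theorem enorm_sq_eq_lintegral {α F : Type*} [MeasurableSpace α] {μ : Measure α}
    [NormedAddCommGroup F] (u : Lp F 2 μ) : ‖u‖ₑ ^ 2 = ∫⁻ x, ‖u x‖ₑ ^ 2 ∂μ := by
  rw [Lp.enorm_def, eLpNorm_eq_lintegral_rpow_enorm_toReal (by norm_num) (by norm_num)]
  simp only [ENNReal.toReal_ofNat, ENNReal.rpow_ofNat]
  rw [← ENNReal.rpow_natCast, ← ENNReal.rpow_mul]
  norm_num

theorem sobolevNorm_sq (s : ℝ) (u : L2Config d N) :
    sobolevNorm s u ^ 2 = ∫⁻ ξ : Config d N,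
      ENNReal.ofReal (sobolevWeight s ξ) * ‖(𝓕 u : L2Config d N) ξ‖ₑ ^ 2 := by
  have h : ‖u‖ₑ = ‖(𝓕 u : L2Config d N)‖ₑ := by
    rw [← ofReal_norm, ← ofReal_norm, Lp.norm_fourier_eq]
  have h2 : Measurable fun ξ : Config d N ↦ ENNReal.ofReal ((2 * Real.pi * ‖ξ‖) ^ (2 * s)) := by
    fun_prop
  rw [sobolevNorm, ← ENNReal.rpow_natCast, ← ENNReal.rpow_mul, h, enorm_sq_eq_lintegral,
    homSobolevSq, ← lintegral_add_left']
  · simp only [ofReal_sobolevWeight, add_mul, one_mul]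
    norm_num
  · exact ((Lp.aestronglyMeasurable _).enorm.pow_const _)

theorem norm_inv_sqrt_sobolevWeight_smul_le {E : Type*} [NormedAddCommGroup E] (s : ℝ) (ξ : E)
    (z : ℂ) : ‖((√(sobolevWeight s ξ))⁻¹ : ℝ) • z‖ ≤ ‖z‖ := by
  rw [norm_smul, Real.norm_of_nonneg (by positivity)]
  exact mul_le_of_le_one_left (norm_nonneg _)
    (inv_le_one_of_one_le₀ (Real.one_le_sqrt.2 (one_le_sobolevWeight s ξ)))

theorem memLp_inv_sqrt_sobolevWeight_smul (s : ℝ) (u : L2Config d N) :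
    MemLp (fun ξ ↦ ((√(sobolevWeight s ξ))⁻¹ : ℝ) • u ξ) 2 volume :=
  (Lp.memLp u).of_le
    (((measurable_sobolevWeight s).sqrt.inv.aestronglyMeasurable).smul (Lp.aestronglyMeasurable u))
    (Filter.Eventually.of_forall fun _ ↦ norm_inv_sqrt_sobolevWeight_smul_le s _ _)

/-- Multiplication by `(1 + |2πξ|^{2s})^{-1/2}` on `L²`. -/
def sobolevMultiplier (d N : ℕ) (s : ℝ) : L2Config d N →L[ℂ] L2Config d N :=
  LinearMap.mkContinuous
    { toFun := fun u ↦ (memLp_inv_sqrt_sobolevWeight_smul s u).toLp _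
      map_add' := fun u v ↦ by
        rw [← MemLp.toLp_add, MemLp.toLp_eq_toLp_iff]
        filter_upwards [Lp.coeFn_add u v] with ξ h
        simp only [h, Pi.add_apply, smul_add]
      map_smul' := fun c u ↦ by
        rw [RingHom.id_apply, ← MemLp.toLp_const_smul, MemLp.toLp_eq_toLp_iff]
        filter_upwards [Lp.coeFn_smul c u] with ξ h
        simp only [h, Pi.smul_apply, smul_comm c] } 1 fun u ↦ by
    rw [one_mul]
    refine Lp.norm_le_norm_of_ae_le ?_
    dsimp only [LinearMap.coe_mk, AddHom.coe_mk]
    filter_upwards [(memLp_inv_sqrt_sobolevWeight_smul s u).coeFn_toLp] with ξ h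
    rw [h]
    exact norm_inv_sqrt_sobolevWeight_smul_le s _ _

theorem coeFn_sobolevMultiplier (s : ℝ) (u : L2Config d N) :
    sobolevMultiplier d N s u =ᵐ[volume] fun ξ ↦ ((√(sobolevWeight s ξ))⁻¹ : ℝ) • u ξ :=
  (memLp_inv_sqrt_sobolevWeight_smul s u).coeFn_toLp

/-- The Bessel-type operator `(1 + (-Δ)^s)^{-1/2}`, an isometry from `L²` onto `H^s`. -/
def sobolevLift (d N : ℕ) (s : ℝ) : L2Config d N →L[ℂ] L2Config d N :=
  (Lp.fourierTransformₗᵢ (Config d N) ℂ).symm.toContinuousLinearEquiv.toContinuousLinearMap ∘L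
    sobolevMultiplier d N s

theorem fourier_sobolevLift (s : ℝ) (u : L2Config d N) :
    𝓕 (sobolevLift d N s u) = sobolevMultiplier d N s u :=
  (Lp.fourierTransformₗᵢ (Config d N) ℂ).apply_symm_apply _

theorem coeFn_fourier_sobolevLift (s : ℝ) (u : L2Config d N) :
    (𝓕 (sobolevLift d N s u) : L2Config d N) =ᵐ[volume]
      fun ξ ↦ ((√(sobolevWeight s ξ))⁻¹ : ℝ) • u ξ := by
  rw [fourier_sobolevLift]; exact coeFn_sobolevMultiplier s u

theorem sobolevNorm_sobolevLift (s : ℝ) (u : L2Config d N) :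
    sobolevNorm s (sobolevLift d N s u) = ‖u‖ₑ := by
  have : sobolevNorm s (sobolevLift d N s u) ^ 2 = ‖u‖ₑ ^ 2 := by
    rw [sobolevNorm_sq, enorm_sq_eq_lintegral]
    refine lintegral_congr_ae ?_
    filter_upwards [coeFn_fourier_sobolevLift s u] with ξ h
    have hp := sobolevWeight_pos s ξ
    rw [h, enorm_smul, mul_pow, ← mul_assoc, Real.enorm_of_nonneg (by positivity),
      ← ENNReal.ofReal_pow (by positivity), ← ENNReal.ofReal_mul hp.le, inv_pow,
      Real.sq_sqrt hp.le, mul_inv_cancel₀ hp.ne', ENNReal.ofReal_one, one_mul]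
  exact (ENNReal.pow_right_strictMono two_ne_zero).injective this

theorem sobolevLift_injective (s : ℝ) : Function.Injective (sobolevLift d N s) := by
  rw [injective_iff_map_eq_zero]
  intro u hu
  have h := sobolevNorm_sobolevLift s u
  rw [hu, ← map_zero (sobolevLift d N s), sobolevNorm_sobolevLift] at h
  simpa using h.symm

/-- The preimage of `u` is `√(sobolevWeight s) • 𝓕 u`: the argument of `sobolevLift` is a function
of the frequency. -/
theorem mem_sobolevSpace_iff {s : ℝ} {u : L2Config d N} :
    u ∈ sobolevSpace d N s ↔ ∃ b, sobolevLift d N s b = u := by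
  constructor
  · intro hu
    have hfin : sobolevNorm s u ^ 2 < ⊤ := ENNReal.pow_lt_top hu
    rw [sobolevNorm_sq] at hfin
    have hmem : MemLp (fun ξ : Config d N ↦ (√(sobolevWeight s ξ) : ℝ) • (𝓕 u : L2Config d N) ξ)
        2 volume := by
      refine ⟨((measurable_sobolevWeight s).sqrt.aestronglyMeasurable).smul
        (Lp.aestronglyMeasurable _), ?_⟩
      rw [eLpNorm_lt_top_iff_lintegral_rpow_enorm_lt_top (by norm_num) (by norm_num)]
      simp only [ENNReal.toReal_ofNat, ENNReal.rpow_ofNat]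
      convert hfin using 3 with ξ
      have hp := sobolevWeight_pos s ξ
      rw [enorm_smul, mul_pow, Real.enorm_of_nonneg (by positivity),
        ← ENNReal.ofReal_pow (by positivity), Real.sq_sqrt hp.le]
    refine ⟨hmem.toLp _, ?_⟩
    apply (Lp.fourierTransformₗᵢ (Config d N) ℂ).injective
    change (𝓕 (sobolevLift d N s (hmem.toLp _)) : L2Config d N) = 𝓕 u
    refine Lp.ext ?_
    filter_upwards [coeFn_fourier_sobolevLift s (hmem.toLp _), hmem.coeFn_toLp] with ξ h1 h2
    have hp := sobolevWeight_pos s ξ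
    rw [h1, h2, smul_smul, inv_mul_cancel₀ (by positivity), one_smul]
  · rintro ⟨b, rfl⟩
    change sobolevNorm s _ < ⊤
    rw [sobolevNorm_sobolevLift]
    exact enorm_lt_top

theorem sobolevLift_mem_sobolevSpace (s : ℝ) (b : L2Config d N) :
    sobolevLift d N s b ∈ sobolevSpace d N s :=
  mem_sobolevSpace_iff.2 ⟨b, rfl⟩

/-- Since the lift is isometric onto `H^s`, closures for the `H^s` norm become ordinary closures in
`L²`, where Hilbert space arguments apply. -/
theorem sobolevLift_mem_sobolevClosure_iff {s : ℝ} {S : Set (L2Config d N)} {b : L2Config d N} :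
    sobolevLift d N s b ∈ sobolevClosure s S ↔ b ∈ closure (sobolevLift d N s ⁻¹' S) := by
  rw [EMetric.mem_closure_iff]
  constructor
  · rintro ⟨-, h⟩ ε hε
    obtain ⟨v, hvS, hv, hlt⟩ := h ε hε
    obtain ⟨c, rfl⟩ := mem_sobolevSpace_iff.1 hv
    refine ⟨c, hvS, ?_⟩
    rwa [← map_sub, sobolevNorm_sobolevLift, ← edist_eq_enorm_sub] at hlt
  · intro h
    refine ⟨sobolevLift_mem_sobolevSpace s b, fun ε hε ↦ ?_⟩
    obtain ⟨c, hc, hlt⟩ := h ε hε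
    refine ⟨_, hc, sobolevLift_mem_sobolevSpace s c, ?_⟩
    rwa [← map_sub, sobolevNorm_sobolevLift, ← edist_eq_enorm_sub]

theorem sobolevClosure_mono {s : ℝ} {S T : Set (L2Config d N)} (h : S ⊆ T) :
    sobolevClosure s S ⊆ sobolevClosure s T :=
  fun _ hu ↦ ⟨hu.1, fun ε hε ↦
    let ⟨v, hv, hv'⟩ := hu.2 ε hε
    ⟨v, h hv, hv'⟩⟩

theorem sobolevClosure_subset_of_subset {s : ℝ} {S T : Set (L2Config d N)}
    (h : S ⊆ sobolevClosure s T) : sobolevClosure s S ⊆ sobolevClosure s T := by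
  intro u hu
  obtain ⟨b, rfl⟩ := mem_sobolevSpace_iff.1 hu.1
  rw [sobolevLift_mem_sobolevClosure_iff] at hu ⊢
  refine closure_minimal (fun c hc ↦ ?_) isClosed_closure hu
  exact sobolevLift_mem_sobolevClosure_iff.1 (h hc)

/-- Subspaces are weakly sequentially closed: an `H^s`-bounded sequence in a subspace `V` that
converges in `L²` to some `u ∈ H^s` has its limit in the `H^s` closure of `V`. -/
theorem mem_sobolevClosure_of_bounded_of_tendsto {s : ℝ} (V : Submodule ℂ (L2Config d N))
    {u : L2Config d N} (hu : u ∈ sobolevSpace d N s) {v : ℕ → L2Config d N} (hv : ∀ n, v n ∈ V)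
    {C : ℝ≥0∞} (hC : C ≠ ⊤) (hvC : ∀ n, sobolevNorm s (v n) ≤ C)
    (hlim : Filter.Tendsto v Filter.atTop (nhds u)) :
    u ∈ sobolevClosure s (V : Set (L2Config d N)) := by
  obtain ⟨a, rfl⟩ := mem_sobolevSpace_iff.1 hu
  have hvs : ∀ n, ∃ b, sobolevLift d N s b = v n := fun n ↦
    mem_sobolevSpace_iff.1 ((hvC n).trans_lt hC.lt_top)
  choose b hb using hvs
  obtain rfl : (fun n ↦ sobolevLift d N s (b n)) = v := funext hb
  rw [sobolevLift_mem_sobolevClosure_iff]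
  have := mem_topologicalClosure_of_bounded_of_tendsto (sobolevLift d N s)
    (sobolevLift_injective s) (V.comap (sobolevLift d N s).toLinearMap) (a := a) (b := b)
    hv (C := C.toReal) (fun n ↦ ?_) hlim
  · simpa [← SetLike.mem_coe, Submodule.topologicalClosure_coe] using this
  · have := hvC n
    rw [sobolevNorm_sobolevLift] at this
    simpa using ENNReal.toReal_mono hC this

end

/-! ### Bounding the `H^s` norm by derivatives of integer order. -/

noncomputable section

open LineDeriv in
/-- Plancherel for pure directional derivatives of Schwartz functions. -/
theorem lintegral_inner_pow_mul_fourier {E : Type*} [NormedAddCommGroup E] [InnerProductSpace ℝ E]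
    [FiniteDimensional ℝ E] [MeasurableSpace E] [BorelSpace E] (g : SchwartzMap E ℂ) (b : E)
    (k : ℕ) :
    ∫⁻ ξ, ENNReal.ofReal (((2 * Real.pi * inner ℝ ξ b) ^ 2) ^ k) * ‖(𝓕 g : SchwartzMap E ℂ) ξ‖ₑ ^ 2 =
      ‖(∂^{fun _ : Fin k ↦ b} g : SchwartzMap E ℂ).toLp 2 (volume : Measure E)‖ₑ ^ 2 := by
  have key : ∀ (n : ℕ) (ξ : E), ‖(𝓕 (∂^{fun _ : Fin n ↦ b} g) : SchwartzMap E ℂ) ξ‖ₑ ^ 2 =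
      ENNReal.ofReal (((2 * Real.pi * inner ℝ ξ b) ^ 2) ^ n) *
        ‖(𝓕 g : SchwartzMap E ℂ) ξ‖ₑ ^ 2 := by
    intro n ξ
    induction n with
    | zero => simp
    | succ n ih =>
      have hT : (inner ℝ · b : E → ℝ).HasTemperateGrowth := ((innerSL ℝ).flip b).hasTemperateGrowth
      rw [iteratedLineDerivOp_succ_left]
      change ‖(𝓕 (∂_{b} (∂^{fun _ : Fin n ↦ b} g)) : SchwartzMap E ℂ) ξ‖ₑ ^ 2 = _
      rw [SchwartzMap.fourier_lineDerivOp_eq, smul_apply,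
        SchwartzMap.smulLeftCLM_apply_apply hT, enorm_smul, enorm_smul, mul_pow, mul_pow, ih,
        pow_succ ((2 * Real.pi * inner ℝ ξ b) ^ 2) n, mul_comm (_ ^ n),
        ENNReal.ofReal_mul (by positivity), ← mul_assoc, ← mul_assoc]
      congr 2
      rw [← mul_pow, ← ofReal_norm, ← ofReal_norm, ← ENNReal.ofReal_mul (norm_nonneg _),
        ← ENNReal.ofReal_pow (by positivity), ← sq_abs (2 * Real.pi * _)]
      simp [abs_mul, abs_of_pos Real.pi_pos]
  have hF : ‖(∂^{fun _ : Fin k ↦ b} g : SchwartzMap E ℂ).toLp 2 (volume : Measure E)‖ₑ =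
      ‖(𝓕 (∂^{fun _ : Fin k ↦ b} g) : SchwartzMap E ℂ).toLp 2 (volume : Measure E)‖ₑ := by
    rw [← ofReal_norm, ← ofReal_norm, SchwartzMap.norm_fourier_toL2_eq]
  rw [hF, enorm_sq_eq_lintegral]
  refine lintegral_congr_ae ?_
  filter_upwards [(𝓕 (∂^{fun _ : Fin k ↦ b} g) : SchwartzMap E ℂ).coeFn_toLp 2 volume] with ξ h
  rw [h, key]

/-- With `t = 2π‖ξ‖`: `t^{2s} ≤ 1 + t^d` because `2s ≤ d`, then `t^d ≤ R^d + R^{-d} t^{2d}`, then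
the power mean inequality splits `t^{2d}` into coordinates. The constant `3` absorbs two terms `1 ≤
R^d`. Only derivatives of order `d` remain, which the Leibniz rule handles. -/
theorem sobolevWeight_le {E : Type*} [NormedAddCommGroup E] [InnerProductSpace ℝ E] {ι : Type*}
    [Fintype ι] (b : OrthonormalBasis ι ℝ E) {s : ℝ} {d : ℕ} (hd : d ≠ 0) (hs : 0 < 2 * s)
    (hsd : 2 * s ≤ d) {R : ℝ} (hR : 1 ≤ R) (ξ : E) :
    sobolevWeight s ξ ≤ 3 * R ^ d + (Fintype.card ι : ℝ) ^ d * (R ^ d)⁻¹ *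
      ∑ i, ((2 * Real.pi * inner ℝ ξ (b i)) ^ 2) ^ d := by
  have hR0 : 0 < R := by linarith
  set t := 2 * Real.pi * ‖ξ‖ with ht
  have ht0 : 0 ≤ t := by positivity
  have h1 : t ^ (2 * s) ≤ 1 + t ^ d := by
    rcases le_total t 1 with h | h
    · have := Real.rpow_le_one ht0 h hs.le
      have : 0 ≤ t ^ d := by positivity
      linarith
    · have := Real.rpow_le_rpow_of_exponent_le h hsd
      rw [Real.rpow_natCast] at this
      linarith
  have hRd : 1 ≤ R ^ d := one_le_pow₀ hR
  have h2 : t ^ d ≤ R ^ d + (R ^ d)⁻¹ * (t ^ 2) ^ d := by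
    have e : (R ^ d)⁻¹ * (t ^ 2) ^ d = (t ^ d) ^ 2 / R ^ d := by
      rw [← pow_mul, ← pow_mul, mul_comm 2 d]; field_simp
    rw [e, ← sub_le_iff_le_add', le_div_iff₀ (by positivity)]
    nlinarith [sq_nonneg (t ^ d - R ^ d), mul_nonneg (pow_nonneg ht0 d) (pow_nonneg hR0.le d)]
  have h3 : (t ^ 2) ^ d ≤ (Fintype.card ι : ℝ) ^ d *
      ∑ i, ((2 * Real.pi * inner ℝ ξ (b i)) ^ 2) ^ d := by
    have e : t ^ 2 = ∑ i, (2 * Real.pi * inner ℝ ξ (b i)) ^ 2 := by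
      rw [ht, mul_pow, ← b.sum_sq_inner_right, Finset.mul_sum]
      simp only [mul_pow, real_inner_comm]
    obtain ⟨k, rfl⟩ := Nat.exists_eq_succ_of_ne_zero hd
    rcases isEmpty_or_nonempty ι with hι | hι
    · rw [e]; simp
    have hc : (1 : ℝ) ≤ Fintype.card ι := by exact_mod_cast Fintype.card_pos
    -- The power mean inequality for exponent `k + 1 = d` costs `card ^ k`, relaxed below to `card ^
    -- d`.
    have := pow_sum_div_card_le_sum_pow (s := Finset.univ)
      (f := fun i ↦ (2 * Real.pi * inner ℝ ξ (b i)) ^ 2) (fun i _ ↦ by positivity) k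
    rw [e]
    rw [div_le_iff₀ (by positivity), Finset.card_univ, mul_comm _ ((Fintype.card ι : ℝ) ^ k)] at this
    refine this.trans ?_
    gcongr
    exact Nat.le_succ k
  have h4 : (R ^ d)⁻¹ * (t ^ 2) ^ d ≤ (R ^ d)⁻¹ * ((Fintype.card ι : ℝ) ^ d *
      ∑ i, ((2 * Real.pi * inner ℝ ξ (b i)) ^ 2) ^ d) := by gcongr
  rw [sobolevWeight, ← ht]
  have e : (Fintype.card ι : ℝ) ^ d * (R ^ d)⁻¹ *
      ∑ i, ((2 * Real.pi * inner ℝ ξ (b i)) ^ 2) ^ d = (R ^ d)⁻¹ * ((Fintype.card ι : ℝ) ^ d *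
      ∑ i, ((2 * Real.pi * inner ℝ ξ (b i)) ^ 2) ^ d) := by ring
  rw [e]
  linarith

open LineDeriv in
/-- The `H^s` norm of a Schwartz function, for `2s ≤ d`, is controlled by its `L²` norm and the
`L²` norms of its pure derivatives of order `d`, at every length scale `R⁻¹ ≤ 1`. -/
theorem sobolevNorm_sq_toLp_le {d N : ℕ} {s : ℝ} (hs : 0 < 2 * s) (hsd : 2 * s ≤ d) :
    ∃ (ι : Type) (_ : Fintype ι) (b : OrthonormalBasis ι ℝ (Config d N)),
      ∀ (g : SchwartzMap (Config d N) ℂ) (R : ℝ), 1 ≤ R →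
      sobolevNorm s (g.toLp 2 volume) ^ 2 ≤
        ENNReal.ofReal (3 * R ^ d) * ‖g.toLp 2 (volume : Measure (Config d N))‖ₑ ^ 2 +
        ENNReal.ofReal ((Fintype.card ι : ℝ) ^ d * (R ^ d)⁻¹) *
          ∑ i, ‖(∂^{fun _ : Fin d ↦ b i} g : SchwartzMap (Config d N) ℂ).toLp 2
            (volume : Measure (Config d N))‖ₑ ^ 2 := by
  have hd : d ≠ 0 := by rintro rfl; norm_num at hsd; linarith
  refine ⟨_, inferInstance, stdOrthonormalBasis ℝ (Config d N), fun g R hR ↦ ?_⟩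
  set b := stdOrthonormalBasis ℝ (Config d N)
  have hF : ‖g.toLp 2 (volume : Measure (Config d N))‖ₑ ^ 2 =
      ∫⁻ ξ, ‖(𝓕 g : SchwartzMap (Config d N) ℂ) ξ‖ₑ ^ 2 := by
    -- Order zero of the derivative formula is Plancherel itself.
    have := lintegral_inner_pow_mul_fourier g 0 0
    simpa using this.symm
  rw [sobolevNorm_sq, SchwartzMap.toLp_fourier_eq, hF]
  simp_rw [← lintegral_inner_pow_mul_fourier]
  have hm : Measurable fun ξ ↦ ‖(𝓕 g : SchwartzMap (Config d N) ℂ) ξ‖ₑ ^ 2 :=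
    ((𝓕 g : SchwartzMap (Config d N) ℂ).continuous.enorm.measurable).pow_const _
  have hm2 : ∀ i, Measurable fun ξ : Config d N ↦
      ENNReal.ofReal (((2 * Real.pi * inner ℝ ξ (b i)) ^ 2) ^ d) *
        ‖(𝓕 g : SchwartzMap (Config d N) ℂ) ξ‖ₑ ^ 2 := fun i ↦ by fun_prop
  rw [← lintegral_finsetSum _ (fun i _ ↦ hm2 i), ← lintegral_const_mul _ hm,
    ← lintegral_const_mul _ (Finset.measurable_fun_sum _ fun i _ ↦ hm2 i),
    ← lintegral_add_left (hm.const_mul _)]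
  refine lintegral_mono_ae ?_
  filter_upwards [(𝓕 g : SchwartzMap (Config d N) ℂ).coeFn_toLp 2 volume] with ξ h
  rw [h, ← Finset.sum_mul, ← mul_assoc, ← add_mul, ← ENNReal.ofReal_sum_of_nonneg
    (fun i _ ↦ by positivity), ← ENNReal.ofReal_mul (by positivity),
    ← ENNReal.ofReal_add (by positivity) (mul_nonneg (by positivity)
      (Finset.sum_nonneg fun i _ ↦ by positivity))]
  gcongr
  exact sobolevWeight_le b hd hs hsd hR ξ

end

/-! ### Derivatives of rescaled cutoffs and volumes of tubes. -/

/-- Leibniz bound for a product with a rescaled cutoff `θ ∘ A`. -/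
theorem exists_norm_iteratedFDeriv_comp_smul_le {E Y : Type*} [NormedAddCommGroup E]
    [NormedSpace ℝ E] [NormedAddCommGroup Y] [NormedSpace ℝ Y] {θ : Y → ℝ} (hθ : ContDiff ℝ ∞ θ)
    (hc : HasCompactSupport θ) (a : ℝ) (k : ℕ) :
    ∃ C : ℝ, 0 ≤ C ∧ ∀ (A : E →L[ℝ] Y) (R : ℝ), 1 ≤ R → ‖A‖ ≤ a * R →
      ∀ Φ : E → ℂ, ContDiff ℝ ∞ Φ → ∀ x,
        ‖iteratedFDeriv ℝ k (fun y ↦ θ (A y) • Φ y) x‖ ≤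
          C * R ^ k * ∑ j ∈ Finset.range (k + 1), ‖iteratedFDeriv ℝ j Φ x‖ := by
  have hM : ∀ j : ℕ, ∃ M : ℝ, ∀ y, ‖iteratedFDeriv ℝ j θ y‖ ≤ M := fun j ↦
    (hθ.continuous_iteratedFDeriv (m := j) (mod_cast le_top)).bounded_above_of_compact_support
      (hc.iteratedFDeriv j)
  choose M hM using hM
  have hM0 : ∀ j, 0 ≤ M j := fun j ↦ (norm_nonneg _).trans (hM j 0)
  have hterm0 : ∀ j, 0 ≤ (k.choose j : ℝ) * (M j * |a| ^ j) := fun j ↦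
    mul_nonneg (by positivity) (mul_nonneg (hM0 j) (by positivity))
  refine ⟨∑ j ∈ Finset.range (k + 1), (k.choose j : ℝ) * (M j * |a| ^ j),
    Finset.sum_nonneg fun j _ ↦ hterm0 j, fun A R hR hA Φ hΦ x ↦ ?_⟩
  have hR0 : 0 ≤ R := by linarith
  refine (norm_iteratedFDeriv_smul_le (N := ∞) (hθ.comp A.contDiff) hΦ x
    (n := k) (mod_cast le_top)).trans ?_
  rw [Finset.sum_mul, Finset.sum_mul]
  refine Finset.sum_le_sum fun j hj ↦ ?_
  have hjk : j ≤ k := Nat.lt_succ_iff.1 (Finset.mem_range.1 hj)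
  have h1 : ‖iteratedFDeriv ℝ j (fun y ↦ θ (A y)) x‖ ≤ M j * |a| ^ j * R ^ k := by
    have e := A.iteratedFDeriv_comp_right hθ x (i := j) (mod_cast le_top)
    rw [Function.comp_def] at e
    rw [e]
    refine (ContinuousMultilinearMap.norm_compContinuousLinearMap_le _ _).trans ?_
    rw [Finset.prod_const, Finset.card_univ, Fintype.card_fin, mul_assoc]
    refine mul_le_mul (hM j _) ?_ (by positivity) (hM0 j)
    calc ‖A‖ ^ j ≤ (|a| * R) ^ j := by
          gcongr
          exact hA.trans (mul_le_mul_of_nonneg_right (le_abs_self a) hR0)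
      _ = |a| ^ j * R ^ j := mul_pow _ _ _
      _ ≤ |a| ^ j * R ^ k := by gcongr
  have h2 : ‖iteratedFDeriv ℝ (k - j) Φ x‖ ≤
      ∑ j ∈ Finset.range (k + 1), ‖iteratedFDeriv ℝ j Φ x‖ :=
    Finset.single_le_sum (f := fun j ↦ ‖iteratedFDeriv ℝ j Φ x‖) (fun _ _ ↦ norm_nonneg _)
      (Finset.mem_range.2 (by omega))
  calc (k.choose j : ℝ) * ‖iteratedFDeriv ℝ j (fun y ↦ θ (A y)) x‖ * ‖iteratedFDeriv ℝ (k - j) Φ x‖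
      ≤ (k.choose j : ℝ) * (M j * |a| ^ j * R ^ k) *
        ∑ j ∈ Finset.range (k + 1), ‖iteratedFDeriv ℝ j Φ x‖ := by
        have := (norm_nonneg _).trans h1
        gcongr
    _ = _ := by ring

/-- A bounded tube of radius `r` around the kernel of a linear map onto `Y` has volume
`O(r ^ dim Y)`. -/
theorem exists_measure_tube_le {E Y : Type*} [NormedAddCommGroup E] [NormedSpace ℝ E]
    [FiniteDimensional ℝ E] [MeasurableSpace E] [BorelSpace E] [NormedAddCommGroup Y]
    [NormedSpace ℝ Y] [FiniteDimensional ℝ Y] (μ : Measure E) [μ.IsAddHaarMeasure]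
    (L : E →L[ℝ] Y) (hL : Function.Surjective L) (ρ : ℝ) :
    ∃ C : ℝ≥0∞, C ≠ ⊤ ∧ ∀ r : ℝ, 0 ≤ r →
      μ (Metric.closedBall 0 ρ ∩ L ⁻¹' Metric.closedBall 0 r) ≤
        ENNReal.ofReal (r ^ Module.finrank ℝ Y) * C := by
  obtain ⟨g, hg⟩ := L.toLinearMap.exists_rightInverse_of_surjective (LinearMap.range_eq_top.2 hL)
  -- A right inverse of `L` splits `E` as `Y × ker L`. The image of `μ` is a multiple of a product
  -- of Haar measures, and the tube maps into a product of balls of which only the one in `Y`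
  -- shrinks with `r`.
  let T : E ≃L[ℝ] Y × L.ker := ContinuousLinearEquiv.equivOfRightInverse L
    (LinearMap.toContinuousLinearMap g) (fun y ↦ LinearMap.congr_fun hg y)
  have hT : ∀ x, (T x).1 = L x := fun x ↦ rfl
  borelize Y
  let ν : Measure Y := Measure.addHaar
  let κ : Measure L.ker := Measure.addHaar
  have hmap : (μ.map T).IsAddHaarMeasure := T.isAddHaarMeasure_map μ
  set c := (μ.map T).addHaarScalarFactor (ν.prod κ)
  have hc : μ.map T = c • ν.prod κ := Measure.isAddLeftInvariant_eq_smul _ _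
  set ρ' := ‖(T : E →L[ℝ] Y × L.ker)‖ * ρ
  refine ⟨c * (ν (Metric.ball 0 1) * κ (Metric.closedBall 0 ρ')), ?_, fun r hr ↦ ?_⟩
  · exact ENNReal.mul_ne_top ENNReal.coe_ne_top (ENNReal.mul_ne_top
      Metric.isBounded_ball.measure_lt_top.ne Metric.isBounded_closedBall.measure_lt_top.ne)
  · have hsub : Metric.closedBall 0 ρ ∩ L ⁻¹' Metric.closedBall 0 r ⊆
        T ⁻¹' (Metric.closedBall (0 : Y) r ×ˢ Metric.closedBall (0 : L.ker) ρ') := by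
      rintro x ⟨hx, hLx⟩
      refine ⟨by rw [hT]; exact hLx, ?_⟩
      rw [mem_closedBall_zero_iff] at hx ⊢
      calc ‖(T x).2‖ ≤ ‖T x‖ := norm_snd_le _
        _ ≤ ‖(T : E →L[ℝ] Y × L.ker)‖ * ‖x‖ := (T : E →L[ℝ] Y × L.ker).le_opNorm x
        _ ≤ _ := mul_le_mul_of_nonneg_left hx
          (ContinuousLinearMap.opNorm_nonneg _)
    refine (measure_mono hsub).trans ?_
    rw [← Measure.map_apply T.continuous.measurable
      (measurableSet_closedBall.prod measurableSet_closedBall), hc, Measure.smul_apply,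
      Measure.prod_prod, Measure.addHaar_closedBall ν _ hr, ENNReal.smul_def, smul_eq_mul]
    apply le_of_eq
    ring

/-! ### `H^s` bounds for Schwartz functions multiplied by a cutoff. -/

noncomputable section

section Schwartz
variable {E : Type*} [NormedAddCommGroup E] [InnerProductSpace ℝ E]

/-- The sum of the norms of all derivatives up to order `k`. -/
def derivSum (k : ℕ) (g : SchwartzMap E ℂ) (x : E) : ℝ :=
  ∑ j ∈ Finset.range (k + 1), ‖iteratedFDeriv ℝ j g x‖

theorem derivSum_nonneg (k : ℕ) (g : SchwartzMap E ℂ) (x : E) : 0 ≤ derivSum k g x :=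
  Finset.sum_nonneg fun _ _ ↦ norm_nonneg _

theorem exists_derivSum_le (k : ℕ) (g : SchwartzMap E ℂ) : ∃ B, ∀ x, derivSum k g x ≤ B :=
  ⟨_, fun x ↦ Finset.sum_le_sum fun j _ ↦ SchwartzMap.norm_iteratedFDeriv_le_seminorm ℝ g j x⟩

theorem norm_le_derivSum (k : ℕ) (g : SchwartzMap E ℂ) (x : E) : ‖g x‖ ≤ derivSum k g x := by
  have := Finset.single_le_sum (f := fun j ↦ ‖iteratedFDeriv ℝ j g x‖)
    (fun _ _ ↦ norm_nonneg _) (Finset.mem_range.2 (Nat.succ_pos k))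
  simpa [derivSum] using this

variable [FiniteDimensional ℝ E] [MeasurableSpace E] [BorelSpace E]

theorem SchwartzMap.enorm_toLp_two_sq (g : SchwartzMap E ℂ) :
    ‖g.toLp 2 (volume : Measure E)‖ₑ ^ 2 = ∫⁻ x, ‖g x‖ₑ ^ 2 := by
  rw [enorm_sq_eq_lintegral]
  refine lintegral_congr_ae ?_
  filter_upwards [g.coeFn_toLp 2 volume] with x h
  rw [h]

/-- A bounded integrable nonnegative function is square integrable. -/
theorem lintegral_ofReal_sq_lt_top {α : Type*} [MeasurableSpace α] {μ : Measure α} {f : α → ℝ}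
    (hf : Integrable f μ) (h0 : ∀ x, 0 ≤ f x) {B : ℝ} (hB : ∀ x, f x ≤ B) :
    ∫⁻ x, ENNReal.ofReal (f x) ^ 2 ∂μ < ⊤ := by
  have h1 : Integrable (fun x ↦ B * f x) μ := hf.const_mul B
  refine lt_of_le_of_lt (lintegral_mono fun x ↦ ?_) (h1.lintegral_lt_top)
  rw [← ENNReal.ofReal_pow (h0 x), sq]
  exact ENNReal.ofReal_le_ofReal (mul_le_mul_of_nonneg_right (hB x) (h0 x))

theorem SchwartzMap.lintegral_norm_mul_sq_lt_top (g : SchwartzMap E ℂ) :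
    ∫⁻ x, ENNReal.ofReal (‖x‖ * ‖g x‖) ^ 2 < ⊤ := by
  refine lintegral_ofReal_sq_lt_top ?_ (fun x ↦ by positivity)
    (fun x ↦ by simpa using SchwartzMap.norm_pow_mul_le_seminorm ℝ g 1 x)
  simpa using SchwartzMap.integrable_pow_mul volume g 1

theorem lintegral_derivSum_sq_lt_top (k : ℕ) (g : SchwartzMap E ℂ) :
    ∫⁻ x, ENNReal.ofReal (derivSum k g x) ^ 2 < ⊤ := by
  obtain ⟨B, hB⟩ := exists_derivSum_le k g
  refine lintegral_ofReal_sq_lt_top ?_ (derivSum_nonneg k g) hB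
  refine integrable_finsetSum _ fun j _ ↦ ?_
  simpa using SchwartzMap.integrable_pow_mul_iteratedFDeriv volume g 0 j

end Schwartz

variable {d N : ℕ}

open LineDeriv in
-- A function varying at length scale `R⁻¹` balances the two terms of the interpolation: `R^d ‖G‖²`
-- and `R^{-d} (R^d)² ‖G‖²` have the same size.
theorem exists_sobolevNorm_sq_toLp_le_of_pointwise {s : ℝ} (hs : 0 < 2 * s) (hsd : 2 * s ≤ d) :
    ∃ K : ℝ≥0∞, K ≠ ⊤ ∧ ∀ (g : SchwartzMap (Config d N) ℂ) (R : ℝ), 1 ≤ R →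
      ∀ G : Config d N → ℝ≥0∞, (∀ x, ‖g x‖ₑ ≤ G x) →
        (∀ x, ‖iteratedFDeriv ℝ d g x‖ₑ ≤ ENNReal.ofReal (R ^ d) * G x) →
        sobolevNorm s (g.toLp 2 volume) ^ 2 ≤ K * (ENNReal.ofReal (R ^ d) * ∫⁻ x, G x ^ 2) := by
  obtain ⟨ι, _, b, h⟩ := sobolevNorm_sq_toLp_le (N := N) hs hsd
  refine ⟨ENNReal.ofReal 3 + ENNReal.ofReal ((Fintype.card ι : ℝ) ^ d) * Fintype.card ι,
    by finiteness, fun g R hR G h0 hd ↦ (h g R hR).trans ?_⟩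
  have hRd : 0 < R ^ d := by positivity
  have e1 : ‖g.toLp 2 (volume : Measure (Config d N))‖ₑ ^ 2 ≤ ∫⁻ x, G x ^ 2 := by
    rw [SchwartzMap.enorm_toLp_two_sq]
    exact lintegral_mono fun x ↦ by gcongr; exact h0 x
  have e2 : ∀ i, ‖(∂^{fun _ : Fin d ↦ b i} g : SchwartzMap (Config d N) ℂ).toLp 2
      (volume : Measure (Config d N))‖ₑ ^ 2 ≤ ENNReal.ofReal (R ^ d) ^ 2 * ∫⁻ x, G x ^ 2 := by
    intro i
    rw [SchwartzMap.enorm_toLp_two_sq, ← lintegral_const_mul' _ _ (by finiteness)]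
    refine lintegral_mono fun x ↦ ?_
    rw [← mul_pow]
    gcongr
    refine le_trans ?_ (hd x)
    rw [SchwartzMap.iteratedLineDerivOp_eq_iteratedFDeriv, ← ofReal_norm, ← ofReal_norm]
    refine ENNReal.ofReal_le_ofReal ?_
    simpa using (iteratedFDeriv ℝ d g x).le_opNorm (fun _ ↦ b i)
  calc _ ≤ ENNReal.ofReal (3 * R ^ d) * (∫⁻ x, G x ^ 2) +
        ENNReal.ofReal ((Fintype.card ι : ℝ) ^ d * (R ^ d)⁻¹) *
          ∑ i : ι, ENNReal.ofReal (R ^ d) ^ 2 * ∫⁻ x, G x ^ 2 := by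
        gcongr with i
        exact e2 i
    _ = ENNReal.ofReal 3 * (ENNReal.ofReal (R ^ d) * ∫⁻ x, G x ^ 2) +
        ENNReal.ofReal ((Fintype.card ι : ℝ) ^ d) * Fintype.card ι *
          ((ENNReal.ofReal (R ^ d)⁻¹ * ENNReal.ofReal (R ^ d)) *
            (ENNReal.ofReal (R ^ d) * ∫⁻ x, G x ^ 2)) := by
        rw [ENNReal.ofReal_mul (by norm_num), ENNReal.ofReal_mul (by positivity),
          Finset.sum_const, Finset.card_univ, nsmul_eq_mul]
        ring
    _ = _ := by
        rw [← ENNReal.ofReal_mul (by positivity), inv_mul_cancel₀ hRd.ne', ENNReal.ofReal_one,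
          one_mul, add_mul]

/-- `H^s` bound for a Schwartz function multiplied by a rescaled cutoff, in terms of the region
containing the support of the product. -/
theorem exists_sobolevNorm_sq_cutoff_le {s : ℝ} (hs : 0 < 2 * s) (hsd : 2 * s ≤ d) {Y : Type*}
    [NormedAddCommGroup Y] [NormedSpace ℝ Y] {θ : Y → ℝ} (hθ : ContDiff ℝ ∞ θ)
    (hc : HasCompactSupport θ) (a : ℝ) :
    ∃ K : ℝ≥0∞, K ≠ ⊤ ∧ ∀ (A : Config d N →L[ℝ] Y) (R : ℝ), 1 ≤ R → ‖A‖ ≤ a * R →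
      ∀ (Φ g : SchwartzMap (Config d N) ℂ), (∀ x, g x = θ (A x) • Φ x) →
      ∀ T : Set (Config d N), MeasurableSet T → tsupport g ⊆ T →
        sobolevNorm s (g.toLp 2 volume) ^ 2 ≤
          K * (ENNReal.ofReal (R ^ d) * ∫⁻ x in T, ENNReal.ofReal (derivSum d Φ x) ^ 2) := by
  obtain ⟨K, hK, h⟩ := exists_sobolevNorm_sq_toLp_le_of_pointwise (N := N) hs hsd
  obtain ⟨C₀, hC₀, h₀⟩ := exists_norm_iteratedFDeriv_comp_smul_le (E := Config d N) hθ hc a 0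
  obtain ⟨C, hC, h₁⟩ := exists_norm_iteratedFDeriv_comp_smul_le (E := Config d N) hθ hc a d
  set M := max C₀ C
  have hM : 0 ≤ M := hC.trans (le_max_right _ _)
  refine ⟨K * ENNReal.ofReal M ^ 2, by finiteness, fun A R hR hA Φ g hg T hT hgT ↦ ?_⟩
  have hgf : (g : Config d N → ℂ) = fun y ↦ θ (A y) • Φ y := funext hg
  have hR0 : 0 ≤ R ^ d := by positivity
  -- The majorant can be cut off to `T` because `g` and its derivatives vanish outside `tsupport g`;
  -- this is where the small volume of `T` enters.
  refine (h g R hR (T.indicator fun x ↦ ENNReal.ofReal (M * derivSum d Φ x)) ?_ ?_).trans_eq ?_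
  · intro x
    by_cases hx : x ∈ T
    · rw [Set.indicator_of_mem hx, ← ofReal_norm]
      refine ENNReal.ofReal_le_ofReal ?_
      have := h₀ A R hR hA Φ (Φ.smooth ⊤) x
      simp only [norm_iteratedFDeriv_zero, pow_zero, mul_one, zero_add, Finset.sum_range_one]
        at this
      rw [hg]
      exact this.trans (mul_le_mul (le_max_left _ _) (norm_le_derivSum d Φ x) (norm_nonneg _) hM)
    · rw [image_eq_zero_of_notMem_tsupport fun h ↦ hx (hgT h)]
      simp
  · intro x
    by_cases hx : x ∈ T
    · rw [Set.indicator_of_mem hx, ← ofReal_norm, ← ENNReal.ofReal_mul hR0]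
      refine ENNReal.ofReal_le_ofReal ?_
      have := h₁ A R hR hA Φ (Φ.smooth ⊤) x
      rw [hgf]
      calc _ ≤ C * R ^ d * derivSum d Φ x := this
        _ ≤ M * R ^ d * derivSum d Φ x := by
          gcongr
          · exact derivSum_nonneg d Φ x
          · exact le_max_right _ _
        _ = _ := by ring
    · have : iteratedFDeriv ℝ d g x = 0 := by
        by_contra hne
        exact hx (hgT (support_iteratedFDeriv_subset d hne))
      rw [this]
      simp
  · have e : ∀ x, T.indicator (fun x ↦ ENNReal.ofReal (M * derivSum d Φ x)) x ^ 2 =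
        T.indicator (fun x ↦ ENNReal.ofReal M ^ 2 * ENNReal.ofReal (derivSum d Φ x) ^ 2) x := by
      intro x
      by_cases hx : x ∈ T
      · rw [Set.indicator_of_mem hx, Set.indicator_of_mem hx, ENNReal.ofReal_mul hM, mul_pow]
      · rw [Set.indicator_of_notMem hx, Set.indicator_of_notMem hx, zero_pow two_ne_zero]
    simp_rw [e]
    rw [lintegral_indicator hT, lintegral_const_mul' _ _ (by finiteness)]
    ring

/-- The classes of the test functions whose support avoids `Z`. -/
def testAvoiding (Z : Set (Config d N)) : Submodule ℂ (L2Config d N) where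
  carrier := {v | ∃ g : SchwartzMap (Config d N) ℂ, HasCompactSupport g ∧ tsupport g ⊆ Zᶜ ∧
    g.toLp 2 volume = v}
  add_mem' := by
    rintro _ _ ⟨f, hf, hfZ, rfl⟩ ⟨g, hg, hgZ, rfl⟩
    exact ⟨f + g, hf.add hg, (tsupport_add _ _).trans (Set.union_subset hfZ hgZ),
      (SchwartzMap.toLpCLM ℂ ℂ 2 (volume : Measure (Config d N))).map_add f g⟩
  zero_mem' := ⟨0, HasCompactSupport.zero, by
    rw [show ((0 : SchwartzMap (Config d N) ℂ) : Config d N → ℂ) = 0 from rfl, tsupport,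
      Function.support_zero, closure_empty]
    exact Set.empty_subset _,
    (SchwartzMap.toLpCLM ℂ ℂ 2 (volume : Measure (Config d N))).map_zero⟩
  smul_mem' := by
    rintro c _ ⟨f, hf, hfZ, rfl⟩
    exact ⟨c • f, hf.smul_left (f := fun _ ↦ c),
      (tsupport_smul_subset_right (fun _ ↦ c) f).trans hfZ,
      (SchwartzMap.toLpCLM ℂ ℂ 2 (volume : Measure (Config d N))).map_smul c f⟩

theorem toLp_mem_sobolevSpace {s : ℝ} (hs : 0 < 2 * s) (hsd : 2 * s ≤ d)
    (g : SchwartzMap (Config d N) ℂ) : g.toLp 2 volume ∈ sobolevSpace d N s := by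
  obtain ⟨ι, _, b, h⟩ := sobolevNorm_sq_toLp_le (N := N) hs hsd
  have hfin : sobolevNorm s (g.toLp 2 volume) ^ 2 < ⊤ :=
    (h g 1 le_rfl).trans_lt (by
      refine ENNReal.add_lt_top.2 ⟨by finiteness, ENNReal.mul_lt_top (by finiteness) ?_⟩
      exact ENNReal.sum_lt_top.2 fun i _ ↦ by finiteness)
  change sobolevNorm s _ < ⊤
  by_contra hne
  rw [not_lt, top_le_iff] at hne
  simp [hne] at hfin

end

/-! ### Removing one plane of codimension `d`. -/

noncomputable section

variable {d N : ℕ}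

theorem tendsto_zero_of_enorm_sq_le {F : Type*} [NormedAddCommGroup F] {u : ℕ → F} {δ : ℕ → ℝ≥0∞}
    (h : ∀ n, ‖u n‖ₑ ^ 2 ≤ δ n) (hδ : Filter.Tendsto δ Filter.atTop (nhds 0)) :
    Filter.Tendsto u Filter.atTop (nhds 0) := by
  rw [tendsto_zero_iff_enorm_tendsto_zero]
  have h2 : Filter.Tendsto (fun n ↦ ‖u n‖ₑ ^ 2) Filter.atTop (nhds 0) :=
    tendsto_of_tendsto_of_tendsto_of_le_of_le tendsto_const_nhds hδ (fun _ ↦ zero_le) h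
  have h3 := (ENNReal.continuous_rpow_const (y := (1 / 2 : ℝ))).tendsto 0 |>.comp h2
  rw [ENNReal.zero_rpow_of_pos (by norm_num)] at h3
  refine h3.congr fun n ↦ ?_
  rw [Function.comp_apply, ← ENNReal.rpow_natCast, ← ENNReal.rpow_mul]
  norm_num

theorem tendsto_inv_ofReal_natCast_add_one_pow {k : ℕ} (hk : k ≠ 0) :
    Filter.Tendsto (fun n : ℕ ↦ ENNReal.ofReal (((n : ℝ) + 1) ^ k)⁻¹) Filter.atTop (nhds 0) := by
  rw [← ENNReal.ofReal_zero]
  refine ENNReal.tendsto_ofReal (Filter.Tendsto.inv_tendsto_atTop ?_)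
  exact (Filter.tendsto_pow_atTop hk).comp
    (Filter.tendsto_atTop_add_const_right _ _ tendsto_natCast_atTop_atTop)

theorem sobolevNorm_le_of_sq_le {s : ℝ} {u : L2Config d N} {C : ℝ≥0∞}
    (h : sobolevNorm s u ^ 2 ≤ C) : sobolevNorm s u ≤ C ^ (1 / 2 : ℝ) := by
  have := ENNReal.rpow_le_rpow h (z := (1 / 2 : ℝ)) (by norm_num)
  rwa [← ENNReal.rpow_natCast, ← ENNReal.rpow_mul, show ((2 : ℕ) : ℝ) * (1 / 2) = 1 by norm_num,
    ENNReal.rpow_one] at this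

theorem sobolevNorm_sub_le {s : ℝ} {u v : L2Config d N} (hu : u ∈ sobolevSpace d N s)
    (hv : v ∈ sobolevSpace d N s) :
    sobolevNorm s (u - v) ≤ sobolevNorm s u + sobolevNorm s v := by
  obtain ⟨a, rfl⟩ := mem_sobolevSpace_iff.1 hu
  obtain ⟨b, rfl⟩ := mem_sobolevSpace_iff.1 hv
  rw [← map_sub]
  simp only [sobolevNorm_sobolevLift]
  exact enorm_sub_le

section cutoff
variable {E Y : Type*} [NormedAddCommGroup E] [InnerProductSpace ℝ E] [NormedAddCommGroup Y]
  [InnerProductSpace ℝ Y] [FiniteDimensional ℝ Y]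

theorem exists_schwartzMap_eq_cutoff_smul (θ : ContDiffBump (0 : Y)) (A : E →L[ℝ] Y)
    {Φ : SchwartzMap E ℂ} (hΦ : HasCompactSupport Φ) :
    ∃ g : SchwartzMap E ℂ, HasCompactSupport g ∧ ∀ x, g x = θ (A x) • Φ x := by
  have hsm : ContDiff ℝ ∞ fun x ↦ θ (A x) • Φ x := (θ.contDiff.comp A.contDiff).smul (Φ.smooth ⊤)
  have hgc : HasCompactSupport fun x ↦ θ (A x) • Φ x :=
    hΦ.mono fun x hx h0 ↦ hx (by simp only [h0, smul_zero])
  exact ⟨hgc.toSchwartzMap hsm, hgc, fun _ ↦ rfl⟩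

theorem norm_le_of_eq_cutoff_smul {θ : ContDiffBump (0 : Y)} {A : E →L[ℝ] Y}
    {Φ g : SchwartzMap E ℂ} (hg : ∀ x, g x = θ (A x) • Φ x) (x : E) : ‖g x‖ ≤ ‖Φ x‖ := by
  rw [hg, norm_smul, Real.norm_of_nonneg θ.nonneg]
  exact mul_le_of_le_one_left (norm_nonneg _) θ.le_one

theorem tsupport_subset_of_eq_cutoff_smul {θ : ContDiffBump (0 : Y)} {L : E →L[ℝ] Y} {R ρ : ℝ}
    (hR : 0 < R) {Φ g : SchwartzMap E ℂ} (hg : ∀ x, g x = θ ((R • L) x) • Φ x)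
    (hρ : tsupport Φ ⊆ Metric.closedBall 0 ρ) :
    tsupport g ⊆ Metric.closedBall 0 ρ ∩ L ⁻¹' Metric.closedBall 0 (θ.rOut / R) := by
  refine closure_minimal (fun x hx ↦ ?_)
    (Metric.isClosed_closedBall.inter (Metric.isClosed_closedBall.preimage L.continuous))
  rw [Function.mem_support, hg, smul_ne_zero_iff] at hx
  refine ⟨hρ (subset_tsupport _ hx.2), ?_⟩
  have h2 : (R • L) x ∈ Metric.ball (0 : Y) θ.rOut := by
    rw [← θ.support_eq]; exact hx.1
  rw [mem_ball_zero_iff, smul_apply, norm_smul, Real.norm_of_nonneg hR.le] at h2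
  rw [Set.mem_preimage, mem_closedBall_zero_iff, le_div_iff₀ hR, mul_comm]
  exact h2.le

/-- The bump equals `1` on a whole ball around `0`, so `Φ - g` vanishes on a neighbourhood of the
kernel of `A`, not merely on it. -/
theorem tsupport_sub_subset_of_eq_cutoff_smul {θ : ContDiffBump (0 : Y)} {A : E →L[ℝ] Y}
    {Φ g : SchwartzMap E ℂ} (hg : ∀ x, g x = θ (A x) • Φ x) :
    tsupport (Φ - g) ⊆ tsupport Φ ∩ {x | A x ≠ 0} := by
  have hval : ∀ x, (Φ - g) x = (1 - θ (A x)) • Φ x := fun x ↦ by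
    rw [sub_apply, hg, sub_smul, one_smul]
  intro x hx
  refine ⟨closure_mono (fun y hy ↦ ?_) hx, fun hxA ↦ (notMem_tsupport_iff_eventuallyEq.2 ?_) hx⟩
  · rw [Function.mem_support, hval, smul_ne_zero_iff] at hy
    exact hy.2
  · have hnear : ∀ᶠ y in nhds x, A y ∈ Metric.closedBall (0 : Y) θ.rIn := by
      refine A.continuous.continuousAt.eventually (Metric.closedBall_mem_nhds_of_mem ?_)
      rw [hxA]
      exact Metric.mem_ball_self θ.rIn_pos
    filter_upwards [hnear] with y hy
    rw [hval, θ.one_of_mem_closedBall hy, sub_self, zero_smul, Pi.zero_apply]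

end cutoff

theorem tendsto_toLp_zero_of_lintegral_le {E : Type*} [NormedAddCommGroup E]
    [InnerProductSpace ℝ E] [FiniteDimensional ℝ E] [MeasurableSpace E] [BorelSpace E]
    {g : ℕ → SchwartzMap E ℂ} {k : ℕ} (hk : k ≠ 0) {D : ℝ≥0∞} (hD : D ≠ ⊤)
    (h : ∀ n, ∫⁻ x, ‖g n x‖ₑ ^ 2 ≤ ENNReal.ofReal (((n : ℝ) + 1) ^ k)⁻¹ * D) :
    Filter.Tendsto (fun n ↦ (g n).toLp 2 (volume : Measure E)) Filter.atTop (nhds 0) := by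
  refine tendsto_zero_of_enorm_sq_le
    (fun n ↦ (SchwartzMap.enorm_toLp_two_sq (g n)).trans_le (h n)) ?_
  simpa using ENNReal.Tendsto.mul_const (tendsto_inv_ofReal_natCast_add_one_pow hk) (Or.inr hD)

theorem setLIntegral_derivSum_sq_tube_le {E Y : Type*} [NormedAddCommGroup E]
    [InnerProductSpace ℝ E] [FiniteDimensional ℝ E] [MeasurableSpace E] [BorelSpace E]
    [NormedAddCommGroup Y] [NormedSpace ℝ Y] [FiniteDimensional ℝ Y] (L : E →L[ℝ] Y)
    (hL : Function.Surjective L) (ρ a : ℝ) (ha : 0 ≤ a) (k : ℕ) (Φ : SchwartzMap E ℂ) :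
    ∃ D : ℝ≥0∞, D ≠ ⊤ ∧ ∀ R : ℝ, 0 < R →
      ∫⁻ x in Metric.closedBall 0 ρ ∩ L ⁻¹' Metric.closedBall 0 (a / R),
        ENNReal.ofReal (derivSum k Φ x) ^ 2 ≤
          ENNReal.ofReal (R ^ Module.finrank ℝ Y)⁻¹ * D := by
  obtain ⟨c, hc, htube⟩ := exists_measure_tube_le (volume : Measure E) L hL ρ
  obtain ⟨B, hB⟩ := exists_derivSum_le k Φ
  refine ⟨ENNReal.ofReal B ^ 2 * (ENNReal.ofReal (a ^ Module.finrank ℝ Y) * c), by finiteness,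
    fun R hR ↦ ?_⟩
  calc _ ≤ ∫⁻ _ in Metric.closedBall 0 ρ ∩ L ⁻¹' Metric.closedBall 0 (a / R),
          ENNReal.ofReal B ^ 2 := lintegral_mono fun x ↦ by
        gcongr; exact hB x
    _ = ENNReal.ofReal B ^ 2 *
        volume (Metric.closedBall 0 ρ ∩ L ⁻¹' Metric.closedBall 0 (a / R)) := by
        rw [setLIntegral_const]
    _ ≤ ENNReal.ofReal B ^ 2 * (ENNReal.ofReal ((a / R) ^ Module.finrank ℝ Y) * c) := by
        gcongr
        exact htube (a / R) (by positivity)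
    _ = _ := by
        rw [div_pow, div_eq_mul_inv, ENNReal.ofReal_mul (by positivity)]
        ring

/-- Planes of codimension `d ≥ 2s` have vanishing `H^s` capacity: test functions that also avoid
the kernel of a surjection onto `ℝ^d` are `H^s`-dense. -/
theorem testAvoiding_subset_sobolevClosure {s : ℝ} (hs : 0 < 2 * s) (hsd : 2 * s ≤ d)
    (L : Config d N →L[ℝ] EuclideanSpace ℝ (Fin d)) (hL : Function.Surjective L)
    (Z : Set (Config d N)) :
    (testAvoiding Z : Set (L2Config d N)) ⊆ sobolevClosure s
      (testAvoiding (Z ∪ {x | L x = 0}) : Set (L2Config d N)) := by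
  rintro _ ⟨Φ, hΦc, hΦZ, rfl⟩
  have hd : d ≠ 0 := by
    rintro rfl
    exact absurd hsd (by simpa using hs)
  let θ : ContDiffBump (0 : EuclideanSpace ℝ (Fin d)) := default
  have hR : ∀ n : ℕ, (1 : ℝ) ≤ n + 1 := fun n ↦ by simp
  have hR0 : ∀ n : ℕ, (0 : ℝ) < n + 1 := fun n ↦ by positivity
  choose g hgc hg using fun n : ℕ ↦
    exists_schwartzMap_eq_cutoff_smul θ (((n : ℝ) + 1) • L) hΦc
  obtain ⟨ρ, hρ⟩ := hΦc.isCompact.isBounded.subset_closedBall 0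
  obtain ⟨D, hD, hvol⟩ := setLIntegral_derivSum_sq_tube_le L hL ρ θ.rOut θ.rOut_pos.le d Φ
  rw [finrank_euclideanSpace_fin] at hvol
  obtain ⟨K, hK, hbound⟩ := exists_sobolevNorm_sq_cutoff_le (N := N) hs hsd
    (θ.contDiff (n := ⊤)) θ.hasCompactSupport ‖L‖
  have hgT := fun n ↦ tsupport_subset_of_eq_cutoff_smul (hR0 n) (hg n) hρ
  have hTm : ∀ r : ℝ, MeasurableSet (Metric.closedBall 0 ρ ∩ L ⁻¹' Metric.closedBall 0 r) :=
    fun r ↦ measurableSet_closedBall.inter (measurableSet_closedBall.preimage L.measurable)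
  have hgnorm : ∀ n, sobolevNorm s ((g n).toLp 2 volume) ≤ (K * D) ^ (1 / 2 : ℝ) := fun n ↦ by
    have hRd : 0 < ((n : ℝ) + 1) ^ d := pow_pos (hR0 n) d
    have hA : ‖((n : ℝ) + 1) • L‖ ≤ ‖L‖ * ((n : ℝ) + 1) := by
      rw [norm_smul, Real.norm_of_nonneg (hR0 n).le, mul_comm]
    refine sobolevNorm_le_of_sq_le ((hbound _ _ (hR n) hA Φ (g n) (hg n) _ (hTm _)
      (hgT n)).trans ?_)
    refine mul_le_mul_right ?_ K
    -- The exact cancellation of `R^d` against the tube volume `R^{-d}`: the codimension equals the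
    -- order of the derivatives used.
    refine (mul_le_mul_right (hvol _ (hR0 n)) _).trans_eq ?_
    rw [← mul_assoc, ← ENNReal.ofReal_mul hRd.le, mul_inv_cancel₀ hRd.ne', ENNReal.ofReal_one,
      one_mul]
  have hgL2 : Filter.Tendsto (fun n ↦ (g n).toLp 2 (volume : Measure (Config d N)))
      Filter.atTop (nhds 0) := by
    refine tendsto_toLp_zero_of_lintegral_le hd hD fun n ↦ ?_
    refine le_trans ?_ (hvol _ (hR0 n))
    rw [← lintegral_indicator (hTm _)]
    refine lintegral_mono fun x ↦ ?_
    by_cases hx : x ∈ Metric.closedBall 0 ρ ∩ L ⁻¹' Metric.closedBall 0 (θ.rOut / ((n : ℝ) + 1))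
    · rw [Set.indicator_of_mem hx, ← ofReal_norm]
      gcongr
      exact (norm_le_of_eq_cutoff_smul (hg n) x).trans (norm_le_derivSum d Φ x)
    · rw [image_eq_zero_of_notMem_tsupport fun h ↦ hx (hgT n h)]
      simp
  have hΦs := toLp_mem_sobolevSpace (N := N) hs hsd Φ
  -- `Φ - g n` avoids the plane, is bounded in `H^s` and tends to `Φ` in `L²`, so weak closedness
  -- applies.
  refine mem_sobolevClosure_of_bounded_of_tendsto _ hΦs
    (v := fun n ↦ Φ.toLp 2 volume - (g n).toLp 2 volume) (fun n ↦ ?_)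
    (C := sobolevNorm s (Φ.toLp 2 volume) + (K * D) ^ (1 / 2 : ℝ)) ?_ (fun n ↦ ?_) ?_
  · refine ⟨Φ - g n, hΦc.sub (hgc n), fun x hx ↦ ?_,
      (SchwartzMap.toLpCLM ℂ ℂ 2 (volume : Measure (Config d N))).map_sub Φ (g n)⟩
    obtain ⟨h1, h2⟩ := tsupport_sub_subset_of_eq_cutoff_smul (hg n) hx
    rintro (hxZ | hxL)
    · exact hΦZ h1 hxZ
    · exact h2 (by rw [smul_apply, show L x = 0 from hxL, smul_zero])
  · exact ENNReal.add_ne_top.2 ⟨(show sobolevNorm s _ < ⊤ from hΦs).ne, by finiteness⟩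
  · exact (sobolevNorm_sub_le hΦs (toLp_mem_sobolevSpace hs hsd _)).trans
      (add_le_add_right (hgnorm n) _)
  · simpa using hgL2.const_sub (Φ.toLp 2 volume)

end

/-! ### Density of test functions and removal of all the planes. -/

noncomputable section

variable {d N : ℕ}

/-- Where the cutoff differs from `1` one has `‖x‖ / R > 1`, so one power of `‖x‖` buys an explicit
rate `R⁻¹`. -/
theorem norm_sub_le_of_eq_cutoff_smul {E : Type*} [NormedAddCommGroup E] [InnerProductSpace ℝ E]
    [FiniteDimensional ℝ E] {θ : ContDiffBump (0 : E)} (hθ : 1 ≤ θ.rIn) {R : ℝ} (hR : 0 < R)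
    {Φ g : SchwartzMap E ℂ} (hg : ∀ x, g x = θ ((R⁻¹ • ContinuousLinearMap.id ℝ E) x) • Φ x)
    (x : E) : ‖(Φ - g) x‖ ≤ R⁻¹ * (‖x‖ * ‖Φ x‖) := by
  have hval : (Φ - g) x = (1 - θ (R⁻¹ • x)) • Φ x := by
    rw [sub_apply, hg, sub_smul, one_smul]
    rfl
  rw [hval, norm_smul, Real.norm_of_nonneg (sub_nonneg.2 θ.le_one), ← mul_assoc]
  refine mul_le_mul_of_nonneg_right ?_ (norm_nonneg _)
  have hn : ‖R⁻¹ • x‖ = R⁻¹ * ‖x‖ := by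
    rw [norm_smul, Real.norm_of_nonneg (inv_nonneg.2 hR.le)]
  by_cases hx : R⁻¹ • x ∈ Metric.closedBall (0 : E) θ.rIn
  · rw [θ.one_of_mem_closedBall hx, sub_self]
    positivity
  · rw [mem_closedBall_zero_iff, hn, not_le] at hx
    have := θ.nonneg (x := R⁻¹ • x)
    linarith

/-- Compactly supported test functions are `H^s`-dense among Schwartz functions. -/
theorem toLp_mem_sobolevClosure_testAvoiding_empty {s : ℝ} (hs : 0 < 2 * s) (hsd : 2 * s ≤ d)
    (Φ : SchwartzMap (Config d N) ℂ) :
    Φ.toLp 2 volume ∈ sobolevClosure s (testAvoiding (∅ : Set (Config d N)) :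
      Set (L2Config d N)) := by
  let θ : ContDiffBump (0 : Config d N) := ⟨1, 2, one_pos, one_lt_two⟩
  have hR : ∀ n : ℕ, (1 : ℝ) ≤ n + 1 := fun n ↦ by simp
  have hR0 : ∀ n : ℕ, (0 : ℝ) < n + 1 := fun n ↦ by positivity
  have hex : ∀ n : ℕ, ∃ g : SchwartzMap (Config d N) ℂ, HasCompactSupport g ∧
      ∀ x, g x = θ ((((n : ℝ) + 1)⁻¹ • ContinuousLinearMap.id ℝ (Config d N)) x) • Φ x := by
    intro n
    have hsm : ContDiff ℝ ∞ fun x ↦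
        θ ((((n : ℝ) + 1)⁻¹ • ContinuousLinearMap.id ℝ (Config d N)) x) • Φ x :=
      (θ.contDiff.comp (ContinuousLinearMap.contDiff _)).smul (Φ.smooth ⊤)
    have hgc : HasCompactSupport fun x ↦
        θ ((((n : ℝ) + 1)⁻¹ • ContinuousLinearMap.id ℝ (Config d N)) x) • Φ x := by
      have h1 : HasCompactSupport fun x : Config d N ↦ θ (((n : ℝ) + 1)⁻¹ • x) :=
        θ.hasCompactSupport.comp_smul (inv_ne_zero (hR0 n).ne')
      exact h1.mono fun x hx h0 ↦ hx (by
        change θ (((n : ℝ) + 1)⁻¹ • x) • Φ x = 0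
        rw [show θ (((n : ℝ) + 1)⁻¹ • x) = 0 from h0, zero_smul])
    exact ⟨hgc.toSchwartzMap hsm, hgc, fun _ ↦ rfl⟩
  choose g hgc hg using hex
  obtain ⟨K, hK, hbound⟩ := exists_sobolevNorm_sq_cutoff_le (N := N) hs hsd
    (θ.contDiff (n := ⊤)) θ.hasCompactSupport 1
  have hDtop := lintegral_derivSum_sq_lt_top d Φ
  set D := ∫⁻ x, ENNReal.ofReal (derivSum d Φ x) ^ 2
  have hgnorm : ∀ n, sobolevNorm s ((g n).toLp 2 volume) ≤ (K * D) ^ (1 / 2 : ℝ) := fun n ↦ by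
    -- Widening cutoffs have linear part of norm at most `1`, so the bound is used at the fixed
    -- scale `R = 1` with no restriction on the region.
    refine sobolevNorm_le_of_sq_le ((hbound _ 1 le_rfl ?_ Φ (g n) (hg n) Set.univ
      MeasurableSet.univ (Set.subset_univ _)).trans_eq ?_)
    · rw [norm_smul, mul_one, Real.norm_of_nonneg (inv_nonneg.2 (hR0 n).le)]
      exact mul_le_one₀ (inv_le_one_of_one_le₀ (hR n)) (norm_nonneg _)
        ContinuousLinearMap.norm_id_le
    · rw [one_pow, ENNReal.ofReal_one, one_mul, setLIntegral_univ]
  have hlim : Filter.Tendsto (fun n ↦ (Φ - g n).toLp 2 (volume : Measure (Config d N)))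
      Filter.atTop (nhds 0) := by
    have hE := Φ.lintegral_norm_mul_sq_lt_top
    refine tendsto_toLp_zero_of_lintegral_le two_ne_zero hE.ne fun n ↦ ?_
    rw [← lintegral_const_mul' _ _ (by finiteness)]
    refine lintegral_mono fun x ↦ ?_
    rw [← inv_pow, ENNReal.ofReal_pow (inv_nonneg.2 (hR0 n).le), ← mul_pow,
      ← ENNReal.ofReal_mul (inv_nonneg.2 (hR0 n).le), ← ofReal_norm]
    gcongr
    exact norm_sub_le_of_eq_cutoff_smul (θ := θ) le_rfl (hR0 n) (hg n) x
  refine mem_sobolevClosure_of_bounded_of_tendsto _ (toLp_mem_sobolevSpace hs hsd Φ)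
    (fun n ↦ ⟨g n, hgc n, by simp, rfl⟩) (C := (K * D) ^ (1 / 2 : ℝ)) (by finiteness) hgnorm ?_
  have h2 := hlim.const_sub (Φ.toLp 2 volume)
  rw [sub_zero] at h2
  refine h2.congr fun n ↦ ?_
  have := (SchwartzMap.toLpCLM ℂ ℂ 2 (volume : Measure (Config d N))).map_sub Φ (g n)
  simp only [SchwartzMap.toLpCLM_apply] at this
  rw [this, sub_sub_cancel]

/-- Schwartz functions are dense in `H^s`. -/
theorem sobolevSpace_subset_sobolevClosure_range_toLp {s : ℝ} (hs : 0 < 2 * s) (hsd : 2 * s ≤ d) :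
    sobolevSpace d N s ⊆ sobolevClosure s (Set.range fun g : SchwartzMap (Config d N) ℂ ↦
      g.toLp 2 (volume : Measure (Config d N))) := by
  intro u hu
  obtain ⟨a, rfl⟩ := mem_sobolevSpace_iff.1 hu
  rw [sobolevLift_mem_sobolevClosure_iff]
  let S : Submodule ℂ (L2Config d N) :=
    LinearMap.range (SchwartzMap.toLpCLM ℂ ℂ 2 (volume : Measure (Config d N))).toLinearMap
  let W : Submodule ℂ (L2Config d N) := S.comap (sobolevLift d N s).toLinearMap
  have hW : W.topologicalClosure = ⊤ := by
    rw [Submodule.topologicalClosure_eq_top_iff, Submodule.eq_bot_iff]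
    intro h hh
    rw [Submodule.mem_orthogonal] at hh
    have hloc : LocallyIntegrable (fun ξ ↦ √(sobolevWeight s ξ) • h ξ) volume :=
      LocallyIntegrable.continuous_smul (continuous_sobolevWeight (by linarith)).sqrt
        ((Lp.memLp h).locallyIntegrable one_le_two)
    have hzero := ae_eq_zero_of_integral_contDiff_smul_eq_zero hloc fun φ hφ hφc ↦ by
      have hc : HasCompactSupport fun x ↦ (φ x : ℂ) :=
        hφc.comp_left (g := ((↑) : ℝ → ℂ)) Complex.ofReal_zero
      let ψ : SchwartzMap (Config d N) ℂ :=
        hc.toSchwartzMap (Complex.ofRealCLM.contDiff.comp hφ)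
      -- The lift of `b = √(sobolevWeight s) φ` is the inverse Fourier transform of `φ`, a Schwartz
      -- function; thus `h ⟂ b` says that `√(sobolevWeight s) h` integrates to zero against `φ`.
      obtain ⟨b, hb⟩ := mem_sobolevSpace_iff.1 (toLp_mem_sobolevSpace hs hsd (𝓕⁻ ψ))
      have hbW : b ∈ W := ⟨𝓕⁻ ψ, hb.symm⟩
      have hFb : (𝓕 (sobolevLift d N s b) : L2Config d N) = ψ.toLp 2 volume := by
        rw [hb, SchwartzMap.toLp_fourier_eq, FourierTransform.fourier_fourierInv_eq]
      rw [← hh b hbW, L2.inner_def]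
      have h1 := coeFn_fourier_sobolevLift s b
      rw [hFb] at h1
      refine integral_congr_ae ?_
      filter_upwards [h1, ψ.coeFn_toLp 2 volume] with ξ e1 e2
      have hp := sobolevWeight_pos s ξ
      have e3 : b ξ = ((√(sobolevWeight s ξ) * φ ξ : ℝ) : ℂ) := by
        have e4 : (φ ξ : ℂ) = (√(sobolevWeight s ξ))⁻¹ • b ξ := by
          rw [← e1, e2]; rfl
        rw [Complex.ofReal_mul, e4, Complex.real_smul, ← mul_assoc, ← Complex.ofReal_mul,
          mul_inv_cancel₀ (by positivity), Complex.ofReal_one, one_mul]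
      rw [e3, RCLike.inner_apply, Complex.conj_ofReal, smul_smul, Complex.real_smul,
        mul_comm (φ ξ), mul_comm (h ξ)]
    refine Lp.ext ?_
    filter_upwards [hzero, Lp.coeFn_zero ℂ 2 (volume : Measure (Config d N))] with ξ e1 e2
    have hp := sobolevWeight_pos s ξ
    rw [e2]
    exact (smul_eq_zero.1 e1).resolve_left (by positivity)
  have ha : a ∈ W.topologicalClosure := hW ▸ Submodule.mem_top
  have e : (W : Set (L2Config d N)) = sobolevLift d N s ⁻¹' Set.range
      fun g : SchwartzMap (Config d N) ℂ ↦ g.toLp 2 (volume : Measure (Config d N)) := rfl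
  rw [← e]
  exact ha

/-- The relative position of particles `i` and `j`. -/
def relativePosition (d : ℕ) {N : ℕ} (i j : Fin N) : Config d N →L[ℝ] EuclideanSpace ℝ (Fin d) :=
  PiLp.proj (𝕜 := ℝ) 2 (fun _ : Fin N ↦ EuclideanSpace ℝ (Fin d)) i -
    PiLp.proj (𝕜 := ℝ) 2 (fun _ : Fin N ↦ EuclideanSpace ℝ (Fin d)) j

theorem relativePosition_apply (i j : Fin N) (x : Config d N) :
    relativePosition d i j x = x i - x j := rfl

theorem relativePosition_surjective {i j : Fin N} (hij : i ≠ j) :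
    Function.Surjective (relativePosition d i j) := fun y ↦
  ⟨WithLp.toLp 2 (Pi.single i y), by
    simp [relativePosition_apply, hij.symm]⟩

/-- Each pair adds one plane to the avoided set, and density survives because the `H^s` closure is
idempotent. -/
theorem sobolevSpace_subset_sobolevClosure_testAvoiding {s : ℝ} (hs : 0 < 2 * s)
    (hsd : 2 * s ≤ d) (F : Finset (Fin N × Fin N)) (hF : ∀ p ∈ F, p.1 ≠ p.2) :
    sobolevSpace d N s ⊆ sobolevClosure s
      (testAvoiding {x : Config d N | ∃ p ∈ F, x p.1 = x p.2} : Set (L2Config d N)) := by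
  induction F using Finset.induction_on with
  | empty =>
    refine (sobolevSpace_subset_sobolevClosure_range_toLp hs hsd).trans
      (sobolevClosure_subset_of_subset ?_)
    rintro _ ⟨g, rfl⟩
    simpa using toLp_mem_sobolevClosure_testAvoiding_empty hs hsd g
  | insert p F _ ih =>
    refine (ih fun q hq ↦ hF q (Finset.mem_insert_of_mem hq)).trans
      (sobolevClosure_subset_of_subset ?_)
    have hp : p.1 ≠ p.2 := hF p (Finset.mem_insert_self _ _)
    convert! testAvoiding_subset_sobolevClosure hs hsd (relativePosition d p.1 p.2)
      (relativePosition_surjective hp) _ using 4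
    ext x
    simp [relativePosition_apply, sub_eq_zero, or_comm]

theorem testAvoiding_diagonalSet_subset :
    (testAvoiding (diagonalSet d N) : Set (L2Config d N)) ⊆ testOffDiagonal d N := by
  rintro _ ⟨g, hgc, hg, rfl⟩
  exact ⟨g, g.smooth ⊤, hgc, hg, g.coeFn_toLp 2 volume⟩

theorem testOffDiagonal_subset_testVanishing : testOffDiagonal d N ⊆ testVanishing d N := by
  rintro v ⟨Φ, h1, h2, h3, h4⟩
  exact ⟨Φ, h1, h2, fun x hx ↦ image_eq_zero_of_notMem_tsupport fun h ↦ h3 h hx, h4⟩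

theorem sobolevSpace_subset_hardCoreSpace {s : ℝ} (hs : 0 < 2 * s) (hsd : 2 * s ≤ d) :
    sobolevSpace d N s ⊆ hardCoreSpace d N s := by
  have h := sobolevSpace_subset_sobolevClosure_testAvoiding (N := N) hs hsd
    (Finset.univ.filter fun p ↦ p.1 ≠ p.2) (by simp)
  refine h.trans (sobolevClosure_mono ?_)
  convert! testAvoiding_diagonalSet_subset using 3
  ext x
  simp [diagonalSet]

end

theorem lemmaB3 (d N : ℕ) (hN : 1 ≤ N) (s : ℝ) (hs : 0 < 2 * s) (hsd : 2 * s ≤ (d : ℝ)) :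
    hardCoreSpace d N s = diagonalVanishingSpace d N s ∧
      diagonalVanishingSpace d N s = sobolevSpace d N s := by
  have h1 : hardCoreSpace d N s ⊆ diagonalVanishingSpace d N s :=
    sobolevClosure_mono testOffDiagonal_subset_testVanishing
  have h2 : diagonalVanishingSpace d N s ⊆ sobolevSpace d N s := fun _ hu ↦ hu.1
  have h3 := sobolevSpace_subset_hardCoreSpace (N := N) hs hsd
  exact ⟨h1.antisymm (h2.trans h3), h2.antisymm (h3.trans h1)⟩
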